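/- Let $\Gamma\rightrightarrows\Gamma_0$ be a Lie groupoid with source map $\beta$ and target map $\alpha$ (so $\gamma_1\gamma_2$ is defined when $\beta(\gamma_1)=\alpha(\gamma_2)$), let $G$ be a Lie group with Lie algebra $\mathfrak g$, and let $\pi:P\to\Gamma_0$ be a principal $G$-bundle over $\Gamma\rightrightarrows\Gamma_0$, i.e. a principal right $G$-bundle over the manifold $\Gamma_0$ with a smooth left action of $\Gamma$, $(\gamma,p)\mapsto\gamma\cdot p$ for $\beta(\gamma)=\pi(p)$, which commutes with the action of $G$. Let $Q=\Gamma\times_{\beta,\Gamma_0,\pi}P\rightrightarrows P$ be the transformation groupoid, with source $\beta(\gamma,p)=p$ and target $\alpha(\gamma,p)=\gamma\cdot p$. Let $\theta\in\Omega^1(P)\otimes\mathfrak g$ be a pseudo-connection, i.e. a connection one-form of the principal $G$-bundle $P\to\Gamma_0$ (ignoring the action of $\Gamma$), and let $H_p=\ker\theta_p\subset T_pP$ be its horizontal subspaces. A local bisection $\mathcal L$ of $\Gamma$ is a smooth section $\mathcal L:U\to\Gamma$ of $\beta$ over an open set $U\subset\Gamma_0$ such that $\alpha\circ\mathcal L$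 is a diffeomorphism from $U$ onto an open subset of $\Gamma_0$; it acts on $P$ by $\phi_{\mathcal L}:\pi^{-1}(U)\to P$, $\phi_{\mathcal L}(p)=\mathcal L(\pi(p))\cdot p$. Let $A\to\Gamma_0$ be the Lie algebroid of $\Gamma$, with fibre $A_m=\ker (d\beta)_{1_m}$, and let $\hat A_{\pi(p)}\subset T_pP$ be the subspace generated by its infinitesimal action: the set of the vectors $\hat X(p)$, $X\in A_{\pi(p)}$, where $\hat X(p)$ is the derivative at $1_{\pi(p)}$ in the direction $X$ of the map $\gamma\mapsto\gamma\cdot p$ on $\beta^{-1}(\pi(p))$. Then the following statements are equivalent. 1. $\theta$ is a connection, i.e. the $\mathfrak g$-valued one-form $\partial\theta=\beta^*\theta-\alpha^*\theta$ on $Q$ vanishes. 2. $\theta$ is basic with respect to the action of local bisections, i.e. $\phi_{\mathcal L}^*\theta=\theta$ on $\pi^{-1}(U)$ for every local bisection $\mathcal L:U\to\Gamma$, and $\theta_p$ vanishes on $\hat A_{\pi(p)}$ for every $p\in P$. 3. For every $p\in P$ we have $\hat A_{\pi(p)}\subset H_p$, and the distribution $\{H_p\}_{p\in P}$ is preserved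 by local bisections: $(\phi_{\mathcal L})_*H_p=H_{\phi_{\mathcal L}(p)}$ for every local bisection $\mathcal L:U\to\Gamma$ and every $p\in\pi^{-1}(U)$. -/

import Mathlib

open scoped Manifold ContDiff Topology

noncomputable section

/-!
All manifolds are smooth, finite-dimensional (assumed in the theorem) and without boundary.
Smoothness of a map defined on an embedded submanifold `S` of a manifold `M` is expressed by
`ContMDiffOn` on the set `S`, for any extension of the map to a function on `M`, and its derivative
at `x ∈ S` by `mfderivWithin` on `S`, which is only ever evaluated on vectors tangent to `S`;
there its value does not depend on the extension.
-/

section Groupoid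

variable {E₀ H₀ E₁ H₁ : Type*}
  [NormedAddCommGroup E₀] [NormedSpace ℝ E₀] [TopologicalSpace H₀]
  [NormedAddCommGroup E₁] [NormedSpace ℝ E₁] [TopologicalSpace H₁]

/-- A Lie groupoid `Γ ⇉ Γ₀` with source `src` (the map `β`) and target `tgt` (the map `α`).
The product `mul γ₁ γ₂ = γ₁ γ₂` is meaningful when `src γ₁ = tgt γ₂`; its values on other pairs are
irrelevant. -/
structure LieGroupoid (I₀ : ModelWithCorners ℝ E₀ H₀) (I₁ : ModelWithCorners ℝ E₁ H₁)
    (Γ₀ Γ : Type*) [TopologicalSpace Γ₀] [ChartedSpace H₀ Γ₀]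
    [TopologicalSpace Γ] [ChartedSpace H₁ Γ] where
  src : Γ → Γ₀
  tgt : Γ → Γ₀
  unit : Γ₀ → Γ
  inv : Γ → Γ
  mul : Γ → Γ → Γ
  src_unit : ∀ x, src (unit x) = x
  tgt_unit : ∀ x, tgt (unit x) = x
  src_mul : ∀ γ₁ γ₂, src γ₁ = tgt γ₂ → src (mul γ₁ γ₂) = src γ₂
  tgt_mul : ∀ γ₁ γ₂, src γ₁ = tgt γ₂ → tgt (mul γ₁ γ₂) = tgt γ₁
  mul_assoc : ∀ γ₁ γ₂ γ₃, src γ₁ = tgt γ₂ → src γ₂ = tgt γ₃ →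
    mul (mul γ₁ γ₂) γ₃ = mul γ₁ (mul γ₂ γ₃)
  unit_mul : ∀ γ, mul (unit (tgt γ)) γ = γ
  mul_unit : ∀ γ, mul γ (unit (src γ)) = γ
  src_inv : ∀ γ, src (inv γ) = tgt γ
  tgt_inv : ∀ γ, tgt (inv γ) = src γ
  inv_mul : ∀ γ, mul (inv γ) γ = unit (src γ)
  mul_inv : ∀ γ, mul γ (inv γ) = unit (tgt γ)
  submersion_src : Manifold.IsSubmersion I₁ I₀ ∞ src
  submersion_tgt : Manifold.IsSubmersion I₁ I₀ ∞ tgt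
  smooth_unit : ContMDiff I₀ I₁ ∞ unit
  smooth_inv : ContMDiff I₁ I₁ ∞ inv
  smooth_mul : ContMDiffOn (I₁.prod I₁) I₁ ∞ (fun c : Γ × Γ => mul c.1 c.2)
    {c : Γ × Γ | src c.1 = tgt c.2}

variable {I₀ : ModelWithCorners ℝ E₀ H₀} {I₁ : ModelWithCorners ℝ E₁ H₁}
  {Γ₀ Γ : Type*} [TopologicalSpace Γ₀] [ChartedSpace H₀ Γ₀]
  [TopologicalSpace Γ] [ChartedSpace H₁ Γ]

/-- The fibre `A_m` of the Lie algebroid of the groupoid: the tangent space at the unit `1_m` of the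
source fibre through `1_m`. -/
def LieGroupoid.algebroidFiber (𝒢 : LieGroupoid I₀ I₁ Γ₀ Γ) (m : Γ₀) :
    Submodule ℝ (TangentSpace I₁ (𝒢.unit m)) :=
  LinearMap.ker (mfderiv I₁ I₀ 𝒢.src (𝒢.unit m)).toLinearMap

/-- A local bisection: a smooth section `toFun` of the source map over an open subset `base.source`
of `Γ₀` such that `tgt ∘ toFun` is a diffeomorphism `base` from `base.source` onto an open
subset of `Γ₀`. (The values of `toFun` outside `base.source` are irrelevant.) -/
structure LieGroupoid.LocalBisection (𝒢 : LieGroupoid I₀ I₁ Γ₀ Γ) where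
  toFun : Γ₀ → Γ
  base : OpenPartialHomeomorph Γ₀ Γ₀
  smooth : ContMDiffOn I₀ I₁ ∞ toFun base.source
  src_eq : ∀ x ∈ base.source, 𝒢.src (toFun x) = x
  tgt_eq : ∀ x ∈ base.source, 𝒢.tgt (toFun x) = base x
  smooth_base : ContMDiffOn I₀ I₀ ∞ base base.source
  smooth_base_symm : ContMDiffOn I₀ I₀ ∞ base.symm base.target

end Groupoid

section Bundle

variable {E₀ H₀ E₁ H₁ EG HG EP HP : Type*}
  [NormedAddCommGroup E₀] [NormedSpace ℝ E₀] [TopologicalSpace H₀]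
  [NormedAddCommGroup E₁] [NormedSpace ℝ E₁] [TopologicalSpace H₁]
  [NormedAddCommGroup EG] [NormedSpace ℝ EG] [TopologicalSpace HG]
  [NormedAddCommGroup EP] [NormedSpace ℝ EP] [TopologicalSpace HP]
  {I₀ : ModelWithCorners ℝ E₀ H₀} {I₁ : ModelWithCorners ℝ E₁ H₁}
  {Γ₀ Γ : Type*} [TopologicalSpace Γ₀] [ChartedSpace H₀ Γ₀]
  [TopologicalSpace Γ] [ChartedSpace H₁ Γ]

/-- A principal `G`-bundle over the Lie groupoid `𝒢 = (Γ ⇉ Γ₀)`: a locally trivial principal right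
`G`-bundle `proj : P → Γ₀` with a smooth left action of `𝒢` on `proj : P → Γ₀` commuting with the
`G`-action. The element `act γ p = γ · p` is meaningful when `src γ = proj p`; its other values are
irrelevant. -/
structure GroupoidPrincipalBundle (𝒢 : LieGroupoid I₀ I₁ Γ₀ Γ)
    (IG : ModelWithCorners ℝ EG HG) (IP : ModelWithCorners ℝ EP HP)
    (G P : Type*) [Group G] [TopologicalSpace G] [ChartedSpace HG G]
    [TopologicalSpace P] [ChartedSpace HP P] where
  proj : P → Γ₀
  ract : P → G → P
  act : Γ → P → P
  smooth_proj : ContMDiff IP I₀ ∞ proj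
  smooth_ract : ContMDiff (IP.prod IG) IP ∞ (fun x : P × G => ract x.1 x.2)
  ract_one : ∀ p, ract p 1 = p
  ract_mul : ∀ p g h, ract p (g * h) = ract (ract p g) h
  proj_ract : ∀ p g, proj (ract p g) = proj p
  locally_trivial : ∀ x : Γ₀, ∃ e : Bundle.Trivialization G proj, x ∈ e.baseSet ∧
    ContMDiffOn IP (I₀.prod IG) ∞ e e.source ∧
    ContMDiffOn (I₀.prod IG) IP ∞ e.toOpenPartialHomeomorph.symm e.target ∧
    ∀ p, proj p ∈ e.baseSet → ∀ g, e (ract p g) = ((e p).1, (e p).2 * g)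
  proj_act : ∀ γ p, 𝒢.src γ = proj p → proj (act γ p) = 𝒢.tgt γ
  smooth_act : ContMDiffOn (I₁.prod IP) IP ∞ (fun q : Γ × P => act q.1 q.2)
    {q : Γ × P | 𝒢.src q.1 = proj q.2}
  unit_act : ∀ p, act (𝒢.unit (proj p)) p = p
  act_act : ∀ γ₁ γ₂ p, 𝒢.src γ₂ = proj p → 𝒢.src γ₁ = 𝒢.tgt γ₂ →
    act γ₁ (act γ₂ p) = act (𝒢.mul γ₁ γ₂) p
  act_ract : ∀ γ p g, 𝒢.src γ = proj p → ract (act γ p) g = act γ (ract p g)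

namespace GroupoidPrincipalBundle

variable {𝒢 : LieGroupoid I₀ I₁ Γ₀ Γ}
  {IG : ModelWithCorners ℝ EG HG} {IP : ModelWithCorners ℝ EP HP}
  {G P : Type*} [Group G] [TopologicalSpace G] [ChartedSpace HG G]
  [TopologicalSpace P] [ChartedSpace HP P]

/-- The fibred product `Q = Γ ×_{Γ₀} P`, the space of arrows of the transformation groupoid
`Q ⇉ P`, with source `(γ, p) ↦ p` and target `(γ, p) ↦ γ · p`. It is an embedded submanifold of
`Γ × P`, since `src` is a submersion. -/
def arrows (B : GroupoidPrincipalBundle 𝒢 IG IP G P) : Set (Γ × P) :=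
  {q | 𝒢.src q.1 = B.proj q.2}

/-- The target map of the transformation groupoid. -/
def target (B : GroupoidPrincipalBundle 𝒢 IG IP G P) (q : Γ × P) : P := B.act q.1 q.2

/-- The tangent space `T_q Q`, for `q ∈ Q`: the vectors `u ∈ T_q (Γ × P)` on which the differentials
of `(γ, p) ↦ src γ` and `(γ, p) ↦ proj p` agree. -/
def arrowTangent (B : GroupoidPrincipalBundle 𝒢 IG IP G P) (q : Γ × P) :
    Submodule ℝ (TangentSpace (I₁.prod IP) q) :=
  let dsrc : TangentSpace (I₁.prod IP) q →L[ℝ] E₀ :=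
    mfderiv (I₁.prod IP) I₀ (fun r : Γ × P => 𝒢.src r.1) q
  let dproj : TangentSpace (I₁.prod IP) q →L[ℝ] E₀ :=
    mfderiv (I₁.prod IP) I₀ (fun r : Γ × P => B.proj r.2) q
  LinearMap.ker (dsrc - dproj).toLinearMap

/-- The subspace `Â` of `T_p P` generated by the infinitesimal action of the Lie algebroid: the
vectors `X̂(p)`, for `X` in the fibre of the Lie algebroid at `proj p`, where `X̂(p)` is the
derivative at the unit, in the direction `X`, of the map `γ ↦ γ · p` on the source fibre over
`proj p`. -/
def algebroidDirections (B : GroupoidPrincipalBundle 𝒢 IG IP G P) (p : P) :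
    Submodule ℝ (TangentSpace IP p) :=
  Submodule.map (mfderivWithin I₁ IP (fun γ : Γ => B.act γ p) {γ : Γ | 𝒢.src γ = B.proj p}
      (𝒢.unit (B.proj p)) : TangentSpace I₁ (𝒢.unit (B.proj p)) →L[ℝ] TangentSpace IP p).toLinearMap
    (𝒢.algebroidFiber (B.proj p))

/-- The action `φ_L` of a local bisection `L` on `P`, `p ↦ L(proj p) · p`, defined on the open set
of the `p` with `proj p ∈ L.base.source`. -/
def bisectionAct (B : GroupoidPrincipalBundle 𝒢 IG IP G P) (L : 𝒢.LocalBisection) (p : P) : P :=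
  B.act (L.toFun (B.proj p)) p

/-- The adjoint action of `g` on the Lie algebra `T_1 G`. -/
def lieAd (IG : ModelWithCorners ℝ EG HG) (g : G) :
    GroupLieAlgebra IG G →L[ℝ] GroupLieAlgebra IG G :=
  mfderiv IG IG (fun h : G => g * h * g⁻¹) 1

/-- A pseudo-connection: a smooth connection one-form with values in the Lie algebra of `G` on the
principal `G`-bundle `P → Γ₀` (ignoring the groupoid action), i.e. it reproduces the generators of
the fundamental vector fields and it is `Ad`-equivariant. Smoothness is that of the fibrewise
linear map `T P → 𝔤`. -/
structure PseudoConnection (B : GroupoidPrincipalBundle 𝒢 IG IP G P) [IsManifold IP 1 P] where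
  form : ∀ p : P, TangentSpace IP p →L[ℝ] GroupLieAlgebra IG G
  smooth : ContMDiff (M' := EG) IP.tangent 𝓘(ℝ, EG) ∞
    (fun v : TangentBundle IP P => form v.proj v.snd)
  fundamental : ∀ (p : P) (X : GroupLieAlgebra IG G),
    form p (mfderiv IG IP (fun g : G => B.ract p g) 1 X : TangentSpace IP p) = X
  equivariant : ∀ (p : P) (g : G) (v : TangentSpace IP p),
    form (B.ract p g) (mfderiv IP IP (fun x : P => B.ract x g) p v) = lieAd IG g⁻¹ (form p v)

namespace PseudoConnection

variable [IsManifold IP 1 P] {B : GroupoidPrincipalBundle 𝒢 IG IP G P}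

/-- The `𝔤`-valued one-form `∂θ = β^* θ - α^* θ` on `Q`, at the point `q ∈ Q`, where `β` and `α` are
the source and target maps of `Q ⇉ P`. -/
def partialForm (θ : B.PseudoConnection) (q : Γ × P) :
    B.arrowTangent q →ₗ[ℝ] GroupLieAlgebra IG G :=
  ((θ.form q.2).comp (mfderiv (I₁.prod IP) IP (fun r : Γ × P => r.2) q) -
    (θ.form (B.target q)).comp
      (mfderivWithin (I₁.prod IP) IP B.target B.arrows q)).toLinearMap.domRestrict
    (B.arrowTangent q)

/-- `θ` is a connection: `∂θ = 0` on `Q`. -/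
def IsConnection (θ : B.PseudoConnection) : Prop :=
  ∀ q ∈ B.arrows, θ.partialForm q = 0

/-- `θ` is basic for the action of the local bisections: it is invariant, `φ_L^* θ = θ` for every
local bisection `L`, and horizontal, i.e. it vanishes on the infinitesimal generators of the
action. -/
def IsBasic (θ : B.PseudoConnection) : Prop :=
  (∀ (L : 𝒢.LocalBisection) (p : P), B.proj p ∈ L.base.source → ∀ v : TangentSpace IP p,
    θ.form (B.bisectionAct L p) (mfderiv IP IP (B.bisectionAct L) p v) = θ.form p v) ∧
  ∀ p : P, ∀ v ∈ B.algebroidDirections p, θ.form p v = 0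

/-- The horizontal subspace `H_p`, the kernel of `θ` at `p`. -/
def horizontal (θ : B.PseudoConnection) (p : P) : Submodule ℝ (TangentSpace IP p) :=
  LinearMap.ker (θ.form p).toLinearMap

/-- The horizontal distribution is preserved by the action of the local bisections. -/
def HorizontalPreserved (θ : B.PseudoConnection) : Prop :=
  ∀ (L : 𝒢.LocalBisection) (p : P), B.proj p ∈ L.base.source →
    (θ.horizontal p).map (mfderiv IP IP (B.bisectionAct L) p).toLinearMap =
      θ.horizontal (B.bisectionAct L p)

end PseudoConnection

end GroupoidPrincipalBundle

end Bundle

end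

/-! The key is a splitting of the tangent space of `Q` at `(γ, p)`. Choose a local bisection `L`
through `γ`. The map `y ↦ (L (proj y), y)` takes values in `Q`, so a tangent vector `(X, w)` is the
sum of its image `(l w, w)` of `w` and a vector `(Y, 0)` with `Y` tangent to the source fibre. The
target map sends the first summand to `dφ_L w`, and the second, after right translation by `γ⁻¹`, to
an algebroid direction at `γ · p`. Hence `∂θ = 0` amounts to invariance under the `φ_L` together
with vanishing on algebroid directions. Invariance of `θ` and of its kernel agree: `φ_L` commutes
with `G`, so it carries the fundamental vector of `ξ` to that of `ξ`, and `θ` returns `ξ` on both. A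
form is determined by its kernel and these values. The analytic input is
`LieGroupoid.exists_localBisection`, which combines linear algebra, sections of submersions and the
inverse function theorem. The splitting is used in `isConnection_of_horizontal`, with
`targetDeriv_mem_algebroidDirections` and `HorizontalPreserved.form_mfderiv` treating its two
summands. -/

section LinearAlgebra

/-- Two surjective linear maps out of `V` onto spaces of the same dimension admit a common
complement of their kernels: a section of the one whose composition with the other is bijective. -/
theorem LinearMap.exists_section_bijective {K V W W' : Type*} [Field K]
    [AddCommGroup V] [Module K V] [AddCommGroup W] [Module K W] [AddCommGroup W'] [Module K W']
    [FiniteDimensional K W] [FiniteDimensional K W']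
    (hd : Module.finrank K W = Module.finrank K W')
    (a : V →ₗ[K] W) (b : V →ₗ[K] W') (ha : Function.Surjective a) (hb : Function.Surjective b) :
    ∃ σ : W' →ₗ[K] V, b ∘ₗ σ = LinearMap.id ∧ Function.Bijective (a ∘ₗ σ) := by
  obtain ⟨s, hs⟩ := b.exists_rightInverse_of_surjective (LinearMap.range_eq_top.2 hb)
  have hs' : ∀ w, b (s w) = w := fun w => LinearMap.congr_fun hs w
  set S := a ∘ₗ s with hS
  set q := (LinearMap.range S).mkQ with hq
  have hqS : ∀ w, q (a (s w)) = 0 := fun w =>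
    (Submodule.Quotient.mk_eq_zero _).2 ⟨w, rfl⟩
  -- Subtracting `s (b v)` moves `v` into `ker b` and changes `a v` only by an element of the range
  -- of `S`, so `a` maps `ker b` onto the cokernel of `S`.
  have hsurj : Function.Surjective (q ∘ₗ a ∘ₗ (LinearMap.ker b).subtype) := by
    intro y
    obtain ⟨w, rfl⟩ := Submodule.mkQ_surjective _ y
    obtain ⟨v, rfl⟩ := ha w
    refine ⟨⟨v - s (b v), by simp [hs']⟩, ?_⟩
    change q (a (v - s (b v))) = q (a v)
    rw [map_sub, map_sub, hqS, sub_zero]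
  obtain ⟨r, hr⟩ := LinearMap.exists_rightInverse_of_surjective _ (LinearMap.range_eq_top.2 hsurj)
  have hfr : Module.finrank K (LinearMap.ker S) = Module.finrank K (W ⧸ LinearMap.range S) := by
    have h1 := LinearMap.finrank_range_add_finrank_ker S
    have h2 := Submodule.finrank_quotient_add_finrank (LinearMap.range S)
    omega
  let e := LinearEquiv.ofFinrankEq _ _ hfr
  obtain ⟨p, hp⟩ := (LinearMap.ker S).subtype.exists_leftInverse_of_injective
    (LinearMap.ker_eq_bot.2 (Submodule.injective_subtype _))
  -- The correction takes values in `ker b`, so `s + k` is still a section of `b`; composed with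
  -- `a`, it carries `ker S` isomorphically onto a complement of the range of `S`.
  let k : W' →ₗ[K] V := (LinearMap.ker b).subtype ∘ₗ r ∘ₗ e.toLinearMap ∘ₗ p
  have hqk : ∀ w, q (a (k w)) = e (p w) := fun w => LinearMap.congr_fun hr (e (p w))
  have hbk : ∀ w, b (k w) = 0 := fun w => (r (e (p w))).2
  refine ⟨s + k, LinearMap.ext fun w => by simp [hs', hbk], ?_⟩
  have hinj : Function.Injective (a ∘ₗ (s + k)) := by
    rw [← LinearMap.ker_eq_bot, LinearMap.ker_eq_bot']
    intro w hw
    have hw' : a (s w) + a (k w) = 0 := by simpa using hw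
    have h1 : p w = 0 := by
      have := congrArg q hw'
      rw [map_add, hqS, hqk, zero_add, map_zero] at this
      exact e.map_eq_zero_iff.1 this
    have h2 : k w = 0 := by simp [k, h1]
    have h3 : w ∈ LinearMap.ker S := by
      rw [h2, map_zero, add_zero] at hw'
      exact hw'
    have h4 : p w = ⟨w, h3⟩ := LinearMap.congr_fun hp ⟨w, h3⟩
    rw [h1] at h4
    exact (congrArg Subtype.val h4).symm
  exact ⟨hinj, (LinearMap.injective_iff_surjective_of_finrank_eq_finrank hd.symm).1 hinj⟩

end LinearAlgebra

/-! ### Charts as smooth local homeomorphisms, and the inverse function theorem. -/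

section Charts

variable {E H E' H' M M' : Type*}
  [NormedAddCommGroup E] [NormedSpace ℝ E] [TopologicalSpace H] {I : ModelWithCorners ℝ E H}
  [NormedAddCommGroup E'] [NormedSpace ℝ E'] [TopologicalSpace H'] {I' : ModelWithCorners ℝ E' H'}
  [TopologicalSpace M] [ChartedSpace H M] [TopologicalSpace M'] [ChartedSpace H' M']

/-- On a boundaryless manifold a chart, extended by the model with corners, is a smooth open partial
homeomorphism to the model vector space. -/
theorem OpenPartialHomeomorph.exists_extend_eq [I.Boundaryless] {e : OpenPartialHomeomorph M H}
    (he : e ∈ IsManifold.maximalAtlas I ∞ M) :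
    ∃ φ : OpenPartialHomeomorph M E, φ.toPartialEquiv = e.extend I ∧
      ContMDiffOn I 𝓘(ℝ, E) ∞ φ φ.source ∧ ContMDiffOn 𝓘(ℝ, E) I ∞ φ.symm φ.target := by
  refine ⟨e.trans I.toHomeomorph.toOpenPartialHomeomorph, ?_, ?_, ?_⟩
  · ext <;> simp [ModelWithCorners.toHomeomorph]
  · exact (e.contMDiffOn_extend he).mono (by simp)
  · refine (contMDiffOn_extend_symm he).mono ?_
    intro y hy
    simp [ModelWithCorners.toHomeomorph] at hy
    exact ⟨I.symm y, hy, I.right_inv (by simp [I.range_eq_univ])⟩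

theorem OpenPartialHomeomorph.mdifferentiable_of_contMDiffOn {e : OpenPartialHomeomorph M M'}
    (h : ContMDiffOn I I' ∞ e e.source) (h' : ContMDiffOn I' I ∞ e.symm e.target) :
    e.MDifferentiable I I' :=
  ⟨h.mdifferentiableOn (by simp), h'.mdifferentiableOn (by simp)⟩

/-- The inverse function theorem on boundaryless manifolds. -/
theorem ContMDiffOn.exists_openPartialHomeomorph_eqOn [I.Boundaryless] [I'.Boundaryless]
    [FiniteDimensional ℝ E] [FiniteDimensional ℝ E'] [IsManifold I ∞ M] [IsManifold I' ∞ M']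
    {g : M → M'} {U : Set M} (hU : IsOpen U) (hg : ContMDiffOn I I' ∞ g U) {x : M} (hx : x ∈ U)
    (hbij : Function.Bijective (mfderiv I I' g x)) :
    ∃ e : OpenPartialHomeomorph M M', x ∈ e.source ∧ e.source ⊆ U ∧ Set.EqOn g e e.source ∧
      ContMDiffOn I I' ∞ e e.source ∧ ContMDiffOn I' I ∞ e.symm e.target := by
  obtain ⟨φ, hφ, hφs, hφt⟩ := OpenPartialHomeomorph.exists_extend_eq (I := I)
    (IsManifold.chart_mem_maximalAtlas (I := I) (n := ∞) x)
  obtain ⟨ψ, hψ, hψs, hψt⟩ := OpenPartialHomeomorph.exists_extend_eq (I := I')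
    (IsManifold.chart_mem_maximalAtlas (I := I') (n := ∞) (g x))
  have hxφ : x ∈ φ.source := by
    rw [hφ]; exact mem_extChartAt_source (I := I) x
  have hxψ : g x ∈ ψ.source := by
    rw [hψ]; exact mem_extChartAt_source (I := I') (g x)
  have hV₀ : IsOpen (U ∩ g ⁻¹' ψ.source) := hg.continuousOn.isOpen_inter_preimage hU ψ.open_source
  set V := φ.target ∩ φ.symm ⁻¹' (U ∩ g ⁻¹' ψ.source) with hVdef
  have hV : IsOpen V := φ.isOpen_inter_preimage_symm hV₀
  have hxV : φ x ∈ V := ⟨φ.map_source hxφ, by simp [φ.left_inv hxφ, hx, hxψ]⟩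
  set f : E → E' := ψ ∘ g ∘ φ.symm with hf
  have hfV : ContDiffOn ℝ ∞ f V := by
    rw [← contMDiffOn_iff_contDiffOn]
    exact hψs.comp (hg.comp (hφt.mono fun z hz => hz.1) fun z hz => hz.2.1) fun z hz => hz.2.2
  have hfx : ContDiffAt ℝ ∞ f (φ x) := hfV.contDiffAt (hV.mem_nhds hxV)
  have hφd := OpenPartialHomeomorph.mdifferentiable_of_contMDiffOn hφs hφt
  have hψd := OpenPartialHomeomorph.mdifferentiable_of_contMDiffOn hψs hψt
  have hgx : MDifferentiableAt I I' g x :=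
    (hg.mdifferentiableOn (by simp) x hx).mdifferentiableAt (hU.mem_nhds hx)
  have hbijf : Function.Bijective (fderiv ℝ f (φ x)) := by
    have h1 : HasMFDerivAt 𝓘(ℝ, E) I φ.symm (φ x) (mfderiv 𝓘(ℝ, E) I φ.symm (φ x)) :=
      (hφd.mdifferentiableAt_symm (φ.map_source hxφ)).hasMFDerivAt
    have hl : φ.symm (φ x) = x := φ.left_inv hxφ
    have h2 : HasMFDerivAt I I' g (φ.symm (φ x)) (mfderiv I I' g (φ.symm (φ x))) := by
      rw [hl]; exact hgx.hasMFDerivAt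
    have h3 : HasMFDerivAt I' 𝓘(ℝ, E') ψ (g (φ.symm (φ x))) (mfderiv I' 𝓘(ℝ, E') ψ (g (φ.symm (φ x)))) := by
      rw [hl]; exact (hψd.mdifferentiableAt hxψ).hasMFDerivAt
    have h4 := HasMFDerivAt.comp (φ x) h3 (HasMFDerivAt.comp (φ x) h2 h1)
    rw [← mfderiv_eq_fderiv, h4.mfderiv]
    have b1 : Function.Bijective (mfderiv 𝓘(ℝ, E) I φ.symm (φ x)) :=
      hφd.symm.mfderiv_bijective (φ.map_source hxφ)
    have b2 : Function.Bijective (mfderiv I I' g (φ.symm (φ x))) := by rw [hl]; exact hbij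
    have b3 : Function.Bijective (mfderiv I' 𝓘(ℝ, E') ψ (g (φ.symm (φ x)))) := by
      rw [hl]; exact hψd.mfderiv_bijective hxψ
    exact b3.comp (b2.comp b1)
  let f' : E ≃L[ℝ] E' :=
    (LinearEquiv.ofBijective (fderiv ℝ f (φ x)).toLinearMap hbijf).toContinuousLinearEquiv
  have hf' : (f' : E →L[ℝ] E') = fderiv ℝ f (φ x) := by ext; rfl
  have hder : HasFDerivAt f (f' : E →L[ℝ] E') (φ x) := by
    rw [hf']; exact (hfx.differentiableAt (by simp)).hasFDerivAt
  set e₁ := hfx.toOpenPartialHomeomorph f hder (by simp) with he₁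
  have he₁f : (e₁ : E → E') = f := rfl
  have hxe₁ : φ x ∈ e₁.source := hfx.mem_toOpenPartialHomeomorph_source hder (by simp)
  have hcont : ContinuousOn (fderiv ℝ f) V := hfV.continuousOn_fderiv_of_isOpen hV (by simp)
  -- The inverse is known to be smooth only where the derivative of `f` is invertible. Invertibility
  -- is an open condition and `fderiv ℝ f` is continuous, so shrinking to `W` makes the inverse
  -- smooth on the whole target.
  obtain ⟨W, hWsub, hW, hxW⟩ := mem_nhds_iff.1 (Filter.inter_mem (hV.mem_nhds hxV)
    ((hcont.continuousAt (hV.mem_nhds hxV)).preimage_mem_nhds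
      (by rw [← hf']; exact ContinuousLinearEquiv.nhds f')))
  set e₂ := e₁.restrOpen W hW with he₂
  have he₂f : (e₂ : E → E') = f := rfl
  have he₂W : ∀ z ∈ e₂.source, z ∈ W := fun z hz => hz.2
  have hsymm : ContDiffOn ℝ ∞ e₂.symm e₂.target := by
    intro y hy
    have hz := he₂W _ (e₂.map_target hy)
    obtain ⟨A, hA⟩ := (hWsub hz).2
    have hc : ContDiffAt ℝ ∞ f (e₂.symm y) := hfV.contDiffAt (hV.mem_nhds (hWsub hz).1)
    refine (e₂.contDiffAt_symm hy (f₀' := A) ?_ hc).contDiffWithinAt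
    rw [hA]
    exact (hc.differentiableAt (by simp)).hasFDerivAt
  have heq : Set.EqOn g ((φ.trans e₂).trans ψ.symm) ((φ.trans e₂).trans ψ.symm).source := by
    intro y hy
    simp only [OpenPartialHomeomorph.trans_source, Set.mem_inter_iff, Set.mem_preimage] at hy
    have hyV := (hWsub (he₂W _ hy.1.2)).1
    change g y = ψ.symm (ψ (g (φ.symm (φ y))))
    rw [ψ.left_inv hyV.2.2, φ.left_inv hy.1.1]
  have hsub : ((φ.trans e₂).trans ψ.symm).source ⊆ U := by
    intro y hy
    simp only [OpenPartialHomeomorph.trans_source, Set.mem_inter_iff, Set.mem_preimage] at hy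
    have := (hWsub (he₂W _ hy.1.2)).1.2.1
    rwa [φ.left_inv hy.1.1] at this
  refine ⟨(φ.trans e₂).trans ψ.symm, ?_, hsub, heq,
    (hg.mono hsub).congr fun y hy => (heq hy).symm, ?_⟩
  · refine ⟨⟨hxφ, hxe₁, hxW⟩, ?_⟩
    change ψ (g (φ.symm (φ x))) ∈ ψ.target
    rw [φ.left_inv hxφ]
    exact ψ.map_source hxψ
  · have hs := contMDiffOn_iff_contDiffOn.2 hsymm
    exact hφt.comp (hs.comp (hψs.mono fun y hy => hy.1) fun y hy => hy.2.1) fun y hy => hy.2.2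

end Charts

/-! ### Submersions: normal form, curves in fibres, local sections. -/

section Submersion

variable {E H E' H' M M' : Type*}
  [NormedAddCommGroup E] [NormedSpace ℝ E] [TopologicalSpace H] {I : ModelWithCorners ℝ E H}
  [NormedAddCommGroup E'] [NormedSpace ℝ E'] [TopologicalSpace H'] {I' : ModelWithCorners ℝ E' H'}
  [TopologicalSpace M] [ChartedSpace H M] [TopologicalSpace M'] [ChartedSpace H' M']

theorem OpenPartialHomeomorph.MDifferentiable.exists_hasMFDerivAt
    [IsManifold I 1 M] [IsManifold I' 1 M'] {e : OpenPartialHomeomorph M M'}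
    (he : e.MDifferentiable I I') {x : M} (hx : x ∈ e.source) :
    ∃ A : E ≃L[ℝ] E', HasMFDerivAt I I' e x (A : E →L[ℝ] E') ∧
      HasMFDerivAt I' I e.symm (e x) (A.symm : E' →L[ℝ] E) :=
  ⟨he.mfderiv hx, (he.mdifferentiableAt hx).hasMFDerivAt,
    (he.mdifferentiableAt_symm (e.map_source hx)).hasMFDerivAt⟩

/-- The local normal form of a submersion between boundaryless manifolds, together with the
derivatives of the charts in which it is attained. -/
theorem Manifold.IsSubmersionAt.exists_charts [I.Boundaryless] [I'.Boundaryless]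
    [IsManifold I ∞ M] [IsManifold I' ∞ M'] {f : M → M'} {x : M}
    (h : Manifold.IsSubmersionAt I I' ∞ f x) :
    ∃ (φ : OpenPartialHomeomorph M E) (ψ : OpenPartialHomeomorph M' E') (l : E →L[ℝ] E')
      (A : E ≃L[ℝ] E) (C : E' ≃L[ℝ] E'),
      x ∈ φ.source ∧ f x ∈ ψ.source ∧ Function.Surjective l ∧
      ContMDiffOn 𝓘(ℝ, E) I ∞ φ.symm φ.target ∧ ContMDiffOn I' 𝓘(ℝ, E') ∞ ψ ψ.source ∧
      (∀ z ∈ φ.target, f (φ.symm z) = ψ.symm (l z) ∧ l z ∈ ψ.target) ∧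
      HasMFDerivAt 𝓘(ℝ, E) I φ.symm (φ x) (A.symm : E →L[ℝ] E) ∧
      HasMFDerivAt I' 𝓘(ℝ, E') ψ (f x) (C : E' →L[ℝ] E') ∧
      HasMFDerivAt I I' f x ((C.symm : E' →L[ℝ] E').comp (l.comp (A : E →L[ℝ] E))) := by
  obtain ⟨F, _, _, h⟩ := h
  obtain ⟨φ, hφ, hφs, hφt⟩ := OpenPartialHomeomorph.exists_extend_eq h.domChart_mem_maximalAtlas
  obtain ⟨ψ, hψ, hψs, hψt⟩ := OpenPartialHomeomorph.exists_extend_eq h.codChart_mem_maximalAtlas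
  have hxφ : x ∈ φ.source := by
    rw [hφ, OpenPartialHomeomorph.extend_source]; exact h.mem_domChart_source
  have hxψ : f x ∈ ψ.source := by
    rw [hψ, OpenPartialHomeomorph.extend_source]; exact h.mem_codChart_source
  have : IsManifold I 1 M := .of_le (n := ∞) (by simp)
  have : IsManifold I' 1 M' := .of_le (n := ∞) (by simp)
  have hφd := OpenPartialHomeomorph.mdifferentiable_of_contMDiffOn hφs hφt
  have hψd := OpenPartialHomeomorph.mdifferentiable_of_contMDiffOn hψs hψt
  obtain ⟨A, hA, hA'⟩ := hφd.exists_hasMFDerivAt hxφ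
  obtain ⟨C, hC, hC'⟩ := hψd.exists_hasMFDerivAt hxψ
  set l : E →L[ℝ] E' := (ContinuousLinearMap.fst ℝ E' F).comp (h.equiv : E →L[ℝ] E' × F) with hl
  have hsrc : ∀ y ∈ φ.source, f y ∈ ψ.source := by
    intro y hy
    rw [hφ, OpenPartialHomeomorph.extend_source] at hy
    rw [hψ, OpenPartialHomeomorph.extend_source]
    exact h.source_subset_preimage_source hy
  have key : ∀ y ∈ φ.source, ψ (f y) = l (φ y) := by
    intro y hy
    have h1 := h.writtenInCharts (show φ y ∈ _ by rw [← hφ]; exact φ.map_source hy)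
    rw [← hφ, ← hψ] at h1
    have h2 : ψ (f (φ.symm (φ y))) = l (φ y) := h1
    rwa [φ.left_inv hy] at h2
  have hfy : ∀ y ∈ φ.source, f y = ψ.symm (l (φ y)) := fun y hy => by
    rw [← key y hy, ψ.left_inv (hsrc y hy)]
  refine ⟨φ, ψ, l, A, C, hxφ, hxψ, ?_, hφt, hψs, ?_, hA', hC, ?_⟩
  · intro w
    obtain ⟨z, hz⟩ := h.equiv.surjective (w, 0)
    exact ⟨z, by simp [hl, hz]⟩
  · intro z hz
    have hy := φ.map_target hz
    have := key _ hy
    rw [hfy _ hy, φ.right_inv hz]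
    refine ⟨rfl, ?_⟩
    rw [← φ.right_inv hz, ← key _ hy]
    exact ψ.map_source (hsrc _ hy)
  · have h1 : HasMFDerivAt 𝓘(ℝ, E) 𝓘(ℝ, E') l (φ x) l := l.hasMFDerivAt
    rw [key x hxφ] at hC'
    have h2 := HasMFDerivAt.comp x hC' (HasMFDerivAt.comp x h1 hA)
    refine h2.congr_of_eventuallyEq ?_
    filter_upwards [φ.open_source.mem_nhds hxφ] with y hy using hfy y hy

variable [I.Boundaryless] [I'.Boundaryless] [IsManifold I ∞ M] [IsManifold I' ∞ M']

theorem Manifold.IsSubmersionAt.mfderiv_surjective {f : M → M'} {x : M}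
    (h : Manifold.IsSubmersionAt I I' ∞ f x) : Function.Surjective (mfderiv I I' f x) := by
  obtain ⟨φ, ψ, l, A, C, -, -, hl, -, -, -, -, -, hf⟩ := h.exists_charts
  rw [hf.mfderiv]
  exact C.symm.surjective.comp (hl.comp A.surjective)

/-- Every vector in the kernel of the derivative of a submersion is the velocity of a smooth curve
in the fibre. -/
theorem Manifold.IsSubmersionAt.exists_curve {f : M → M'} {x : M}
    (h : Manifold.IsSubmersionAt I I' ∞ f x) {v : E}
    (hv : (mfderiv I I' f x : E →L[ℝ] E') v = 0) :
    ∃ c : ℝ → M, c 0 = x ∧ ContMDiffAt 𝓘(ℝ, ℝ) I ∞ c 0 ∧ (∀ᶠ t in 𝓝 0, f (c t) = f x) ∧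
      HasMFDerivAt 𝓘(ℝ, ℝ) I c 0 (ContinuousLinearMap.toSpanSingleton ℝ v) := by
  obtain ⟨φ, ψ, l, A, C, hxφ, hxψ, hl, hφt, hψs, hf, hA, hC, hfd⟩ := h.exists_charts
  have hlA : l (A v) = 0 := by
    rw [hfd.mfderiv] at hv
    exact C.symm.map_eq_zero_iff.1 hv
  -- In the charts `f` is the linear map `l`, so a straight line in the direction `A v ∈ ker l`
  -- stays in the fibre.
  set a : ℝ → E := fun t => φ x + t • A v with ha
  have ha0 : a 0 = φ x := by simp [ha]
  have had : ContDiff ℝ ∞ a := by fun_prop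
  have ha' : HasFDerivAt a (ContinuousLinearMap.toSpanSingleton ℝ (A v)) 0 :=
    (ContinuousLinearMap.toSpanSingleton ℝ (A v)).hasFDerivAt.const_add (φ x)
  have hmem : a 0 ∈ φ.target := by rw [ha0]; exact φ.map_source hxφ
  have hev : ∀ᶠ t in 𝓝 0, a t ∈ φ.target :=
    had.continuous.continuousAt.eventually (φ.open_target.mem_nhds hmem)
  refine ⟨φ.symm ∘ a, ?_, ?_, ?_, ?_⟩
  · simp [ha0, φ.left_inv hxφ]
  · exact (hφt.contMDiffAt (φ.open_target.mem_nhds hmem)).comp 0 had.contDiffAt.contMDiffAt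
  · filter_upwards [hev] with t ht
    have h1 := (hf _ (φ.map_source hxφ)).1
    rw [φ.left_inv hxφ] at h1
    rw [Function.comp_apply, (hf _ ht).1, h1]
    simp [ha, hlA]
  · rw [← ha0] at hA
    refine (HasMFDerivAt.comp 0 hA ha'.hasMFDerivAt).congr_mfderiv ?_
    refine ContinuousLinearMap.ext fun t : ℝ => ?_
    change A.symm (t • A v) = t • v
    rw [map_smul, A.symm_apply_apply]

/-- A submersion has local smooth sections with any prescribed derivative that is a right inverse of
its derivative. -/
theorem Manifold.IsSubmersionAt.exists_section {f : M → M'} {x : M}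
    (h : Manifold.IsSubmersionAt I I' ∞ f x) (σ : E' →L[ℝ] E)
    (hσ : (mfderiv I I' f x : E →L[ℝ] E').comp σ = ContinuousLinearMap.id ℝ E') :
    ∃ (s : M' → M) (U : Set M'), IsOpen U ∧ f x ∈ U ∧ s (f x) = x ∧ ContMDiffOn I' I ∞ s U ∧
      (∀ y ∈ U, f (s y) = y) ∧ HasMFDerivAt I' I s (f x) σ := by
  obtain ⟨φ, ψ, l, A, C, hxφ, hxψ, hl, hφt, hψs, hf, hA, hC, hfd⟩ := h.exists_charts
  -- `T` is `σ` read in the charts, a right inverse of `l`; the affine map `a` with linear part `T`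
  -- is then an exact section of `l`.
  set T : E' →L[ℝ] E := (A : E →L[ℝ] E).comp (σ.comp (C.symm : E' →L[ℝ] E')) with hT
  have hlT : ∀ w, l (T w) = w := by
    intro w
    rw [hfd.mfderiv] at hσ
    have h1 : C.symm (l (A (σ (C.symm w)))) = C.symm w := DFunLike.congr_fun hσ (C.symm w)
    exact C.symm.injective h1
  set a : E' → E := fun w => φ x + T (w - ψ (f x)) with ha
  have ha0 : a (ψ (f x)) = φ x := by simp [ha]
  have had : ContDiff ℝ ∞ a := by fun_prop
  have ha' : HasFDerivAt a T (ψ (f x)) :=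
    (T.hasFDerivAt.comp (ψ (f x)) ((hasFDerivAt_id _).sub_const (ψ (f x)))).const_add (φ x)
  have hfx := hf _ (φ.map_source hxφ)
  rw [φ.left_inv hxφ] at hfx
  have hψx : ψ (f x) = l (φ x) := by rw [hfx.1, ψ.right_inv hfx.2]
  have hla : ∀ w, l (a w) = w := fun w => by simp [ha, hlT, ← hψx]
  set U := ψ.source ∩ ψ ⁻¹' (a ⁻¹' φ.target) with hUdef
  have hU : IsOpen U := ψ.isOpen_inter_preimage (φ.open_target.preimage had.continuous)
  refine ⟨φ.symm ∘ a ∘ ψ, U, hU, ⟨hxψ, ?_⟩, ?_, ?_, ?_, ?_⟩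
  · simp [ha0, φ.map_source hxφ]
  · simp [ha0, φ.left_inv hxφ]
  · exact hφt.comp (had.contMDiff.comp_contMDiffOn (hψs.mono fun y hy => hy.1)) fun y hy => hy.2
  · intro y hy
    change f (φ.symm (a (ψ y))) = y
    rw [(hf _ hy.2).1, hla, ψ.left_inv hy.1]
  · rw [← ha0] at hA
    refine (HasMFDerivAt.comp (f x) hA
      (HasMFDerivAt.comp (f x) ha'.hasMFDerivAt hC)).congr_mfderiv ?_
    refine ContinuousLinearMap.ext fun w : E' => ?_
    change A.symm (A (σ (C.symm (C w)))) = σ w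
    rw [A.symm_apply_apply, C.symm_apply_apply]

end Submersion

section

variable {E H E' H' E'' H'' M M' M'' : Type*}
  [NormedAddCommGroup E] [NormedSpace ℝ E] [TopologicalSpace H] {I : ModelWithCorners ℝ E H}
  [NormedAddCommGroup E'] [NormedSpace ℝ E'] [TopologicalSpace H'] {I' : ModelWithCorners ℝ E' H'}
  [NormedAddCommGroup E''] [NormedSpace ℝ E''] [TopologicalSpace H'']
  {I'' : ModelWithCorners ℝ E'' H''}
  [TopologicalSpace M] [ChartedSpace H M] [TopologicalSpace M'] [ChartedSpace H' M']
  [TopologicalSpace M''] [ChartedSpace H'' M'']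

/-- Chain rule for a derivative within a set that contains the values of the inner function. -/
theorem HasMFDerivWithinAt.comp_hasMFDerivAt_of_eventually_mem {g : M' → M''} {f : M → M'}
    {s : Set M'} {x : M} {g' : TangentSpace I' (f x) →L[ℝ] TangentSpace I'' (g (f x))}
    {f' : TangentSpace I x →L[ℝ] TangentSpace I' (f x)}
    (hg : HasMFDerivWithinAt I' I'' g s (f x) g') (hf : HasMFDerivAt I I' f x f')
    (hs : ∀ᶠ y in 𝓝 x, f y ∈ s) : HasMFDerivAt I I'' (g ∘ f) x (g'.comp f') :=
  (HasMFDerivWithinAt.comp x hg (hf.hasMFDerivWithinAt (s := f ⁻¹' s)) subset_rfl).hasMFDerivAt hs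

end

/-! ### Local bisections through a given arrow. -/

section Groupoid

variable {E₀ H₀ E₁ H₁ : Type*}
  [NormedAddCommGroup E₀] [NormedSpace ℝ E₀] [TopologicalSpace H₀]
  [NormedAddCommGroup E₁] [NormedSpace ℝ E₁] [TopologicalSpace H₁]
  {I₀ : ModelWithCorners ℝ E₀ H₀} {I₁ : ModelWithCorners ℝ E₁ H₁}
  {Γ₀ Γ : Type*} [TopologicalSpace Γ₀] [ChartedSpace H₀ Γ₀]
  [TopologicalSpace Γ] [ChartedSpace H₁ Γ]

theorem LieGroupoid.contMDiff_src [IsManifold I₀ ∞ Γ₀] [IsManifold I₁ ∞ Γ]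
    (𝒢 : LieGroupoid I₀ I₁ Γ₀ Γ) : ContMDiff I₁ I₀ ∞ 𝒢.src :=
  𝒢.submersion_src.contMDiff

theorem LieGroupoid.contMDiff_tgt [IsManifold I₀ ∞ Γ₀] [IsManifold I₁ ∞ Γ]
    (𝒢 : LieGroupoid I₀ I₁ Γ₀ Γ) : ContMDiff I₁ I₀ ∞ 𝒢.tgt :=
  𝒢.submersion_tgt.contMDiff

theorem LieGroupoid.LocalBisection.contMDiffAt {𝒢 : LieGroupoid I₀ I₁ Γ₀ Γ}
    (L : 𝒢.LocalBisection) {x : Γ₀} (hx : x ∈ L.base.source) : ContMDiffAt I₀ I₁ ∞ L.toFun x :=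
  L.smooth.contMDiffAt (L.base.open_source.mem_nhds hx)

/-- There is a local bisection through every arrow of a Lie groupoid. -/
theorem LieGroupoid.exists_localBisection [FiniteDimensional ℝ E₀] [FiniteDimensional ℝ E₁]
    [I₀.Boundaryless] [I₁.Boundaryless] [IsManifold I₀ ∞ Γ₀] [IsManifold I₁ ∞ Γ]
    (𝒢 : LieGroupoid I₀ I₁ Γ₀ Γ) (γ : Γ) :
    ∃ L : 𝒢.LocalBisection, 𝒢.src γ ∈ L.base.source ∧ L.toFun (𝒢.src γ) = γ := by
  have hs := 𝒢.submersion_src.isSubmersionAt γ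
  have ht := 𝒢.submersion_tgt.isSubmersionAt γ
  let ds : E₁ →L[ℝ] E₀ := mfderiv I₁ I₀ 𝒢.src γ
  let dt : E₁ →L[ℝ] E₀ := mfderiv I₁ I₀ 𝒢.tgt γ
  -- `σ` prescribes the derivative of a section of `src` so that its composition with `tgt` has
  -- bijective derivative; the inverse function theorem then makes it a bisection.
  obtain ⟨σ, hσ, hbij⟩ := LinearMap.exists_section_bijective rfl dt.toLinearMap ds.toLinearMap
    ht.mfderiv_surjective hs.mfderiv_surjective
  obtain ⟨s, U, hU, hxU, hsx, hsU, hsec, hsd⟩ := hs.exists_section (LinearMap.toContinuousLinearMap σ)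
    (ContinuousLinearMap.ext fun w => LinearMap.congr_fun hσ w)
  have htd : HasMFDerivAt I₁ I₀ 𝒢.tgt (s (𝒢.src γ)) (mfderiv I₁ I₀ 𝒢.tgt (s (𝒢.src γ))) :=
    ((𝒢.contMDiff_tgt _).mdifferentiableAt (by simp)).hasMFDerivAt
  have hcd := HasMFDerivAt.comp _ htd hsd
  obtain ⟨e, hxe, heU, heq, he, he'⟩ := ContMDiffOn.exists_openPartialHomeomorph_eqOn hU
    (𝒢.contMDiff_tgt.comp_contMDiffOn hsU) hxU (by
      rw [hcd.mfderiv, hsx]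
      exact hbij)
  exact ⟨{  toFun := s
            base := e
            smooth := hsU.mono heU
            src_eq := fun x hx => hsec x (heU hx)
            tgt_eq := fun x hx => heq hx
            smooth_base := he
            smooth_base_symm := he' }, hxe, hsx⟩

end Groupoid

/-! ### Derivatives of the groupoid action and algebroid directions. -/

namespace GroupoidPrincipalBundle

variable {E₀ H₀ E₁ H₁ EG HG EP HP : Type*}
  [NormedAddCommGroup E₀] [NormedSpace ℝ E₀] [TopologicalSpace H₀]
  [NormedAddCommGroup E₁] [NormedSpace ℝ E₁] [TopologicalSpace H₁]
  [NormedAddCommGroup EG] [NormedSpace ℝ EG] [TopologicalSpace HG]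
  [NormedAddCommGroup EP] [NormedSpace ℝ EP] [TopologicalSpace HP]
  {I₀ : ModelWithCorners ℝ E₀ H₀} {I₁ : ModelWithCorners ℝ E₁ H₁}
  {Γ₀ Γ : Type*} [TopologicalSpace Γ₀] [ChartedSpace H₀ Γ₀]
  [TopologicalSpace Γ] [ChartedSpace H₁ Γ]
  {𝒢 : LieGroupoid I₀ I₁ Γ₀ Γ}
  {IG : ModelWithCorners ℝ EG HG} {IP : ModelWithCorners ℝ EP HP}
  {G P : Type*} [Group G] [TopologicalSpace G] [ChartedSpace HG G]
  [TopologicalSpace P] [ChartedSpace HP P]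
  (B : GroupoidPrincipalBundle 𝒢 IG IP G P)

/-- The differential of the target map of the transformation groupoid, on the model spaces. -/
noncomputable def targetDeriv (q : Γ × P) : E₁ × EP →L[ℝ] EP :=
  mfderivWithin (I₁.prod IP) IP B.target B.arrows q

theorem hasMFDerivWithinAt_target {q : Γ × P} (hq : q ∈ B.arrows) :
    HasMFDerivWithinAt (I₁.prod IP) IP B.target B.arrows q (B.targetDeriv q) :=
  ((B.smooth_act q hq).mdifferentiableWithinAt (by simp)).hasMFDerivWithinAt

theorem mem_arrowTangent_iff [IsManifold I₀ ∞ Γ₀] [IsManifold I₁ ∞ Γ] (q : Γ × P) (u : E₁ × EP) :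
    u ∈ B.arrowTangent q ↔ (mfderiv I₁ I₀ 𝒢.src q.1 : E₁ →L[ℝ] E₀) u.1 =
      (mfderiv IP I₀ B.proj q.2 : EP →L[ℝ] E₀) u.2 := by
  have h1 : HasMFDerivAt (I₁.prod IP) I₀ (fun r : Γ × P => 𝒢.src r.1) q
      ((mfderiv I₁ I₀ 𝒢.src q.1).comp (ContinuousLinearMap.fst ℝ E₁ EP)) :=
    HasMFDerivAt.comp q ((𝒢.contMDiff_src _).mdifferentiableAt (by simp)).hasMFDerivAt
      (hasMFDerivAt_fst q)
  have h2 : HasMFDerivAt (I₁.prod IP) I₀ (fun r : Γ × P => B.proj r.2) q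
      ((mfderiv IP I₀ B.proj q.2).comp (ContinuousLinearMap.snd ℝ E₁ EP)) :=
    HasMFDerivAt.comp q ((B.smooth_proj _).mdifferentiableAt (by simp)).hasMFDerivAt
      (hasMFDerivAt_snd q)
  unfold arrowTangent
  rw [h1.mfderiv, h2.mfderiv]
  exact sub_eq_zero

section Velocity

variable {E H N : Type*} [NormedAddCommGroup E] [NormedSpace ℝ E] [TopologicalSpace H]
  {I : ModelWithCorners ℝ E H} [TopologicalSpace N] [ChartedSpace H N]

/-- The pair `(a, b)` stays in `arrows` near `x`, so the derivative within that set obeys the chain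
rule. Bisections and orbit curves are both differentiated through this one formula. -/
theorem hasMFDerivAt_act {a : N → Γ} {b : N → P} {x : N} {a' : E →L[ℝ] E₁} {b' : E →L[ℝ] EP}
    (ha : HasMFDerivAt I I₁ a x a') (hb : HasMFDerivAt I IP b x b')
    (hab : ∀ᶠ y in 𝓝 x, 𝒢.src (a y) = B.proj (b y)) :
    HasMFDerivAt I IP (fun y => B.act (a y) (b y)) x ((B.targetDeriv (a x, b x)).comp (a'.prod b')) :=
  (B.hasMFDerivWithinAt_target hab.self_of_nhds).comp_hasMFDerivAt_of_eventually_mem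
    (ha.prodMk hb) hab

/-- Differentiate the identity `src ∘ a = proj ∘ b`. -/
theorem prod_mem_arrowTangent [IsManifold I₀ ∞ Γ₀] [IsManifold I₁ ∞ Γ]
    {a : N → Γ} {b : N → P} {x : N} {a' : E →L[ℝ] E₁} {b' : E →L[ℝ] EP}
    (ha : HasMFDerivAt I I₁ a x a') (hb : HasMFDerivAt I IP b x b')
    (hab : ∀ᶠ y in 𝓝 x, 𝒢.src (a y) = B.proj (b y)) (v : E) :
    ((a' v, b' v) : E₁ × EP) ∈ B.arrowTangent (a x, b x) := by
  rw [mem_arrowTangent_iff]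
  have h1 := HasMFDerivAt.comp x ((𝒢.contMDiff_src (a x)).mdifferentiableAt (by simp)).hasMFDerivAt ha
  have h2 := HasMFDerivAt.comp x ((B.smooth_proj (b x)).mdifferentiableAt (by simp)).hasMFDerivAt hb
  have h3 := hasMFDerivAt_unique (h1.congr_of_eventuallyEq (hab.mono fun y hy => hy.symm)) h2
  exact DFunLike.congr_fun h3 v

end Velocity

/-- The vectors generated by the infinitesimal action of the Lie algebroid are the velocities of the
orbits of the curves in a source fibre that start at the unit. -/
theorem mem_algebroidDirections_iff [I₀.Boundaryless] [I₁.Boundaryless]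
    [IsManifold I₀ ∞ Γ₀] [IsManifold I₁ ∞ Γ] (p : P) (v : EP) :
    v ∈ B.algebroidDirections p ↔ ∃ c : ℝ → Γ, c 0 = 𝒢.unit (B.proj p) ∧
      MDifferentiableAt 𝓘(ℝ, ℝ) I₁ c 0 ∧ (∀ᶠ t in 𝓝 0, 𝒢.src (c t) = B.proj p) ∧
      HasMFDerivAt 𝓘(ℝ, ℝ) IP (fun t => B.act (c t) p) 0
        (ContinuousLinearMap.toSpanSingleton ℝ v) := by
  set S := {γ : Γ | 𝒢.src γ = B.proj p} with hS
  set D : E₁ →L[ℝ] EP :=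
    mfderivWithin I₁ IP (fun γ : Γ => B.act γ p) S (𝒢.unit (B.proj p)) with hD
  have hu : 𝒢.src (𝒢.unit (B.proj p)) = B.proj p := 𝒢.src_unit _
  have hd : HasMFDerivWithinAt I₁ IP (fun γ : Γ => B.act γ p) S (𝒢.unit (B.proj p)) D := by
    have h1 : ContMDiffWithinAt I₁ IP ∞ (fun γ : Γ => B.act γ p) S (𝒢.unit (B.proj p)) :=
      (B.smooth_act (𝒢.unit (B.proj p), p) hu).comp (𝒢.unit (B.proj p))
        ((contMDiff_id.prodMk contMDiff_const).contMDiffAt.contMDiffWithinAt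
          (f := fun γ : Γ => (γ, p))) (fun γ hγ => hγ)
    exact (h1.mdifferentiableWithinAt (by simp)).hasMFDerivWithinAt
  constructor
  · rintro ⟨X, hX, rfl⟩
    obtain ⟨c, hc0, hcs, hcf, hcd⟩ := (𝒢.submersion_src.isSubmersionAt _).exists_curve
      (v := X) hX
    have hcf' : ∀ᶠ t in 𝓝 0, 𝒢.src (c t) = B.proj p := by
      filter_upwards [hcf] with t ht using ht.trans hu
    refine ⟨c, hc0, hcs.mdifferentiableAt (by simp), hcf', ?_⟩
    rw [← hc0] at hd
    refine (hd.comp_hasMFDerivAt_of_eventually_mem hcd hcf').congr_mfderiv ?_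
    refine ContinuousLinearMap.ext fun t : ℝ => ?_
    exact map_smul D t X
  · rintro ⟨c, hc0, hcd, hcf, hv⟩
    have hc := hcd.hasMFDerivAt
    set c' : ℝ →L[ℝ] E₁ := mfderiv 𝓘(ℝ, ℝ) I₁ c 0 with hc'
    -- The velocity of `c` lies in the algebroid fibre because `src ∘ c` is constant near `0`.
    refine ⟨c' 1, ?_, ?_⟩
    · have h1 := HasMFDerivAt.comp 0
        ((𝒢.contMDiff_src (c 0)).mdifferentiableAt (by simp)).hasMFDerivAt hc
      have h2 := hasMFDerivAt_unique h1
        ((hasMFDerivAt_const (I := 𝓘(ℝ, ℝ)) (I' := I₀) (B.proj p) (0 : ℝ)).congr_of_eventuallyEq hcf)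
      rw [hc0] at h2
      exact DFunLike.congr_fun h2 (1 : ℝ)
    · rw [← hc0] at hd
      have h1 := hasMFDerivAt_unique (hd.comp_hasMFDerivAt_of_eventually_mem hc hcf) hv
      have h2 : D (c' 1) = (1 : ℝ) • v := DFunLike.congr_fun h1 (1 : ℝ)
      rw [one_smul] at h2
      exact h2

/-! ### The action of local bisections on the bundle. -/

section Bisection

variable {B} {L : 𝒢.LocalBisection} {p : P}

theorem eventually_proj_mem (hp : B.proj p ∈ L.base.source) :
    ∀ᶠ y in 𝓝 p, B.proj y ∈ L.base.source :=
  B.smooth_proj.continuous.continuousAt.eventually (L.base.open_source.mem_nhds hp)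

theorem hasMFDerivAt_toFun_proj (hp : B.proj p ∈ L.base.source) :
    HasMFDerivAt IP I₁ (fun y => L.toFun (B.proj y)) p
      (mfderiv IP I₁ (fun y => L.toFun (B.proj y)) p) :=
  MDifferentiableAt.hasMFDerivAt
    (((L.contMDiffAt hp).comp p (B.smooth_proj p)).mdifferentiableAt (by simp))

theorem eventually_src_toFun_proj (hp : B.proj p ∈ L.base.source) :
    ∀ᶠ y in 𝓝 p, 𝒢.src (L.toFun (B.proj y)) = B.proj y :=
  (eventually_proj_mem hp).mono fun _ hy => L.src_eq _ hy

theorem hasMFDerivAt_bisectionAct (hp : B.proj p ∈ L.base.source) :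
    HasMFDerivAt IP IP (B.bisectionAct L) p ((B.targetDeriv (L.toFun (B.proj p), p)).comp
      ((mfderiv IP I₁ (fun y => L.toFun (B.proj y)) p : EP →L[ℝ] E₁).prod
        (ContinuousLinearMap.id ℝ EP))) :=
  B.hasMFDerivAt_act (hasMFDerivAt_toFun_proj hp) (hasMFDerivAt_id p) (eventually_src_toFun_proj hp)

theorem proj_bisectionAct (hp : B.proj p ∈ L.base.source) :
    B.proj (B.bisectionAct L p) = L.base (B.proj p) := by
  rw [bisectionAct, B.proj_act _ _ (L.src_eq _ hp), L.tgt_eq _ hp]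

theorem bisectionAct_ract (hp : B.proj p ∈ L.base.source) (g : G) :
    B.bisectionAct L (B.ract p g) = B.ract (B.bisectionAct L p) g := by
  rw [bisectionAct, bisectionAct, B.proj_ract, B.act_ract _ _ _ (L.src_eq _ hp)]

/-- The action of a local bisection has a differentiable local right inverse, hence a surjective
differential. -/
theorem mfderiv_bisectionAct_surjective (hp : B.proj p ∈ L.base.source) :
    Function.Surjective (mfderiv IP IP (B.bisectionAct L) p) := by
  set q₀ := B.bisectionAct L p with hq₀
  have hq₀p : B.proj q₀ = L.base (B.proj p) := proj_bisectionAct hp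
  have hq₀t : B.proj q₀ ∈ L.base.target := by rw [hq₀p]; exact L.base.map_source hp
  have hq₀s : L.base.symm (B.proj q₀) = B.proj p := by rw [hq₀p, L.base.left_inv hp]
  have hev : ∀ᶠ q in 𝓝 q₀, B.proj q ∈ L.base.target :=
    B.smooth_proj.continuous.continuousAt.eventually (L.base.open_target.mem_nhds hq₀t)
  -- The inverse of the bisection's arrow that ends at `proj q`; acting by it undoes `bisectionAct
  -- L`.
  set a : P → Γ := fun q => 𝒢.inv (L.toFun (L.base.symm (B.proj q))) with ha
  have hsrc : ∀ q, B.proj q ∈ L.base.target → 𝒢.src (L.toFun (L.base.symm (B.proj q))) =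
      L.base.symm (B.proj q) := fun q hq => L.src_eq _ (L.base.map_target hq)
  have htgt : ∀ q, B.proj q ∈ L.base.target → 𝒢.tgt (L.toFun (L.base.symm (B.proj q))) =
      B.proj q := fun q hq => by rw [L.tgt_eq _ (L.base.map_target hq), L.base.right_inv hq]
  have ha_src : ∀ q, B.proj q ∈ L.base.target → 𝒢.src (a q) = B.proj q := fun q hq => by
    rw [ha, 𝒢.src_inv, htgt q hq]
  have had : MDifferentiableAt IP I₁ a q₀ := by
    have h1 : ContMDiffAt IP I₀ ∞ (fun q => L.base.symm (B.proj q)) q₀ :=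
      (L.smooth_base_symm.contMDiffAt (L.base.open_target.mem_nhds hq₀t)).comp q₀
        (B.smooth_proj q₀)
    have h2 : ContMDiffAt IP I₁ ∞ (fun q => L.toFun (L.base.symm (B.proj q))) q₀ :=
      (L.contMDiffAt (L.base.map_target hq₀t)).comp q₀ h1
    exact ((𝒢.smooth_inv _).comp q₀ h2).mdifferentiableAt (by simp)
  have hψ := B.hasMFDerivAt_act had.hasMFDerivAt (hasMFDerivAt_id q₀) (hev.mono ha_src)
  set ψ : P → P := fun q => B.act (a q) q with hψdef
  have hψq₀ : ψ q₀ = p := by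
    have h1 := L.src_eq _ hp
    rw [hψdef]
    simp only [ha, hq₀s]
    rw [hq₀, bisectionAct, B.act_act _ _ _ h1 (𝒢.src_inv _), 𝒢.inv_mul, h1, B.unit_act]
  have hright : ∀ q, B.proj q ∈ L.base.target → B.bisectionAct L (ψ q) = q := by
    intro q hq
    have h1 : B.proj (ψ q) = L.base.symm (B.proj q) := by
      rw [hψdef, B.proj_act _ _ (ha_src q hq), ha, 𝒢.tgt_inv, hsrc q hq]
    rw [bisectionAct, h1, hψdef, B.act_act _ _ _ (ha_src q hq) (𝒢.tgt_inv _).symm, ha,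
      𝒢.mul_inv, htgt q hq, B.unit_act]
  have hφ : HasMFDerivAt IP IP (B.bisectionAct L) (ψ q₀) (mfderiv IP IP (B.bisectionAct L) (ψ q₀)) := by
    rw [hψq₀]
    exact (hasMFDerivAt_bisectionAct hp).mdifferentiableAt.hasMFDerivAt
  have hcomp := hasMFDerivAt_unique (HasMFDerivAt.comp q₀ hφ hψ)
    ((hasMFDerivAt_id q₀).congr_of_eventuallyEq (hev.mono hright))
  rw [hψq₀] at hcomp
  exact fun w => ⟨_, DFunLike.congr_fun hcomp w⟩

end Bisection

/-- Moving an arrow in its source fibre moves its action on a point in the direction of the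
Lie algebroid. -/
theorem targetDeriv_mem_algebroidDirections
    [I₀.Boundaryless] [I₁.Boundaryless] [IsManifold I₀ ∞ Γ₀] [IsManifold I₁ ∞ Γ]
    {γ : Γ} {p : P} (hγ : 𝒢.src γ = B.proj p) {Y : E₁}
    (hY : (mfderiv I₁ I₀ 𝒢.src γ : E₁ →L[ℝ] E₀) Y = 0) :
    B.targetDeriv (γ, p) (Y, 0) ∈ B.algebroidDirections (B.act γ p) := by
  obtain ⟨c, hc0, hcs, hcf, hcd⟩ := (𝒢.submersion_src.isSubmersionAt γ).exists_curve hY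
  have hpγ : B.proj (B.act γ p) = 𝒢.tgt γ := B.proj_act γ p hγ
  have hmul : ∀ t, 𝒢.src (c t) = 𝒢.src γ → 𝒢.src (c t) = 𝒢.tgt (𝒢.inv γ) := fun t ht => by
    rw [ht, 𝒢.tgt_inv]
  -- Right translation by `γ⁻¹` turns a curve through `γ` into one through the unit at `tgt γ`,
  -- still in a source fibre, and `(c γ⁻¹) · (γ · p) = c · p` leaves the orbit curve unchanged.
  refine (B.mem_algebroidDirections_iff _ _).2 ⟨fun t => 𝒢.mul (c t) (𝒢.inv γ), ?_, ?_, ?_, ?_⟩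
  · simp only [hc0, 𝒢.mul_inv, hpγ]
  · have h1 : ContMDiffWithinAt 𝓘(ℝ, ℝ) I₁ ∞ (fun t => 𝒢.mul (c t) (𝒢.inv γ))
        {t | 𝒢.src (c t) = 𝒢.src γ} 0 :=
      (𝒢.smooth_mul (c 0, 𝒢.inv γ) (hmul 0 (by rw [hc0]))).comp (0 : ℝ)
        ((hcs.prodMk contMDiffAt_const).contMDiffWithinAt (f := fun t => (c t, 𝒢.inv γ)))
        fun t ht => hmul t ht
    exact (h1.contMDiffAt hcf).mdifferentiableAt (by simp)
  · filter_upwards [hcf] with t ht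
    rw [𝒢.src_mul _ _ (hmul t ht), 𝒢.src_inv, hpγ]
  · have hcf' : ∀ᶠ t in 𝓝 0, 𝒢.src (c t) = B.proj p := hcf.mono fun t ht => ht.trans hγ
    have hconst : HasMFDerivAt 𝓘(ℝ, ℝ) IP (fun _ : ℝ => p) 0 (0 : ℝ →L[ℝ] EP) :=
      hasMFDerivAt_const p (0 : ℝ)
    have h1 := B.hasMFDerivAt_act hcd hconst hcf'
    have h2 : (fun t => B.act (𝒢.mul (c t) (𝒢.inv γ)) (B.act γ p)) =ᶠ[𝓝 0]
        fun t => B.act (c t) p := by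
      filter_upwards [hcf] with t ht
      rw [B.act_act _ _ _ hγ (by rw [𝒢.src_mul _ _ (hmul t ht), 𝒢.src_inv]),
        𝒢.mul_assoc _ _ _ (hmul t ht) (𝒢.src_inv γ), 𝒢.inv_mul, ← ht, 𝒢.mul_unit]
    refine (h1.congr_of_eventuallyEq h2).congr_mfderiv ?_
    rw [hc0]
    refine ContinuousLinearMap.ext fun t : ℝ => ?_
    change B.targetDeriv (γ, p) (t • Y, 0) = t • B.targetDeriv (γ, p) (Y, 0)
    rw [← map_smul, Prod.smul_mk, smul_zero]

/-! ### The three implications. -/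

namespace PseudoConnection

variable {B} [IsManifold IP 1 P] (θ : B.PseudoConnection)

/-- The form on the model spaces. -/
noncomputable def modelForm (p : P) : EP →L[ℝ] EG := θ.form p

/-- Stated on the fixed model spaces, the condition can be rewritten along equalities of base points
such as `act (unit _) p = p`. -/
theorem isConnection_iff : θ.IsConnection ↔ ∀ q ∈ B.arrows, ∀ u : E₁ × EP,
    u ∈ B.arrowTangent q →
      θ.modelForm (B.act q.1 q.2) (B.targetDeriv q u) = θ.modelForm q.2 u.2 := by
  have key : ∀ q u (hu : u ∈ B.arrowTangent q), θ.partialForm q ⟨u, hu⟩ =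
      (θ.modelForm q.2 (u : E₁ × EP).2 - θ.modelForm (B.act q.1 q.2) (B.targetDeriv q u) : EG) := by
    intro q u hu
    unfold partialForm
    rw [mfderiv_snd]
    rfl
  refine forall₂_congr fun q hq => ⟨fun h u hu => ?_, fun h => ?_⟩
  · have h1 := key q u hu
    rw [h] at h1
    exact (sub_eq_zero.1 h1.symm).symm
  · refine LinearMap.ext fun ⟨u, hu⟩ => ?_
    rw [key q u hu]
    exact sub_eq_zero.2 (h u hu).symm

variable {θ}

/-- Both halves evaluate `∂θ` on particular vectors: those tangent to the graph `y ↦ (L (proj y),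
y)` give invariance, and those of the form `(X, 0)` at a unit give horizontality, since their source
component is zero. -/
theorem IsConnection.isBasic [I₀.Boundaryless] [I₁.Boundaryless]
    [IsManifold I₀ ∞ Γ₀] [IsManifold I₁ ∞ Γ] (h : θ.IsConnection) : θ.IsBasic := by
  rw [isConnection_iff] at h
  refine ⟨fun L p hp v => ?_, fun p v hv => ?_⟩
  · rw [(hasMFDerivAt_bisectionAct hp).mfderiv]
    exact h (L.toFun (B.proj p), p) (L.src_eq _ hp) _ (B.prod_mem_arrowTangent
      (hasMFDerivAt_toFun_proj hp) (hasMFDerivAt_id p) (eventually_src_toFun_proj hp) v)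
  · obtain ⟨c, hc0, hcd, hcf, hv⟩ := (B.mem_algebroidDirections_iff p v).1 hv
    have hconst : HasMFDerivAt 𝓘(ℝ, ℝ) IP (fun _ : ℝ => p) 0 (0 : ℝ →L[ℝ] EP) :=
      hasMFDerivAt_const p (0 : ℝ)
    obtain ⟨c', hc'⟩ : ∃ c' : ℝ →L[ℝ] E₁, HasMFDerivAt 𝓘(ℝ, ℝ) I₁ c 0 c' :=
      ⟨_, hcd.hasMFDerivAt⟩
    have h1 := hasMFDerivAt_unique (B.hasMFDerivAt_act hc' hconst hcf) hv
    have h2 : B.targetDeriv (c 0, p) (c' 1, 0) = (1 : ℝ) • (v : EP) :=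
      DFunLike.congr_fun h1 (1 : ℝ)
    have h3 : θ.modelForm (B.act (c 0) p) (B.targetDeriv (c 0, p) (c' 1, 0)) = θ.modelForm p 0 :=
      h _ hcf.self_of_nhds _ (B.prod_mem_arrowTangent hc' hconst hcf 1)
    have h4 : B.act (c 0) p = p := by rw [hc0, B.unit_act]
    rw [h2, one_smul, h4, map_zero] at h3
    exact h3

theorem IsBasic.horizontal (h : θ.IsBasic) :
    (∀ p : P, B.algebroidDirections p ≤ θ.horizontal p) ∧ θ.HorizontalPreserved := by
  refine ⟨fun p v hv => h.2 p v hv, fun L p hp => le_antisymm ?_ fun w hw => ?_⟩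
  · rintro _ ⟨v, hv, rfl⟩
    exact (h.1 L p hp v).trans hv
  -- Invariance alone gives only one inclusion; the other needs every `w` to be an image.
  · obtain ⟨v, rfl⟩ := mfderiv_bisectionAct_surjective hp w
    exact ⟨v, (h.1 L p hp v).symm.trans hw, rfl⟩

/-- A connection form is invariant under the local bisections that preserve its kernel, since its
values on the vertical vectors are invariant. -/
theorem HorizontalPreserved.form_mfderiv (h : θ.HorizontalPreserved) (L : 𝒢.LocalBisection) {p : P}
    (hp : B.proj p ∈ L.base.source) (v : EP) :
    θ.modelForm (B.bisectionAct L p) ((mfderiv IP IP (B.bisectionAct L) p : EP →L[ℝ] EP) v) =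
      θ.modelForm p v := by
  have hr : ∀ p, HasMFDerivAt IG IP (fun g : G => B.ract p g) 1
      (mfderiv IG IP (fun g : G => B.ract p g) 1) := fun p =>
    MDifferentiableAt.hasMFDerivAt
      (((B.smooth_ract (p, 1)).comp (1 : G) ((contMDiff_const.prodMk contMDiff_id).contMDiffAt
        (f := fun g : G => (p, g)))).mdifferentiableAt (by simp))
  set R : EG →L[ℝ] EP := mfderiv IG IP (fun g : G => B.ract p g) 1 with hR
  set R' : EG →L[ℝ] EP := mfderiv IG IP (fun g : G => B.ract (B.bisectionAct L p) g) 1 with hR'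
  set D : EP →L[ℝ] EP := mfderiv IP IP (B.bisectionAct L) p with hD
  have hφ : HasMFDerivAt IP IP (B.bisectionAct L) (B.ract p 1) D := by
    rw [B.ract_one]
    exact (hasMFDerivAt_bisectionAct hp).mdifferentiableAt.hasMFDerivAt
  have h1 := HasMFDerivAt.comp (1 : G) hφ (hr p)
  have h2 := hasMFDerivAt_unique h1 ((hr (B.bisectionAct L p)).congr_of_eventuallyEq
    (Filter.Eventually.of_forall fun g => bisectionAct_ract hp g))
  -- Split `v` into the vertical vector `R ξ` and the horizontal remainder `v - R ξ`: `D` sends the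
  -- first to the fundamental vector `R' ξ` and keeps the second horizontal.
  set ξ : EG := θ.modelForm p v with hξ
  have hDR : D (R ξ) = R' ξ := DFunLike.congr_fun h2 ξ
  have hf : θ.modelForm p (R ξ) = ξ := θ.fundamental p ξ
  have hf' : θ.modelForm (B.bisectionAct L p) (R' ξ) = ξ := θ.fundamental (B.bisectionAct L p) ξ
  have hhor : D (v - R ξ) ∈ θ.horizontal (B.bisectionAct L p) := by
    rw [← h L p hp]
    refine ⟨v - R ξ, ?_, rfl⟩
    change θ.modelForm p (v - R ξ) = 0
    rw [map_sub, hf, sub_self]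
  have hhor' : θ.modelForm (B.bisectionAct L p) (D (v - R ξ)) = 0 := hhor
  rw [map_sub, map_sub, hDR, hf', sub_eq_zero] at hhor'
  exact hhor'

theorem isConnection_of_horizontal [FiniteDimensional ℝ E₀] [FiniteDimensional ℝ E₁]
    [I₀.Boundaryless] [I₁.Boundaryless] [IsManifold I₀ ∞ Γ₀] [IsManifold I₁ ∞ Γ]
    (h : ∀ p : P, B.algebroidDirections p ≤ θ.horizontal p) (h' : θ.HorizontalPreserved) :
    θ.IsConnection := by
  rw [isConnection_iff]
  rintro ⟨γ, p⟩ hq u hu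
  have hγp : 𝒢.src γ = B.proj p := hq
  obtain ⟨L, hL, hLγ⟩ := 𝒢.exists_localBisection γ
  rw [hγp] at hL hLγ
  set l : EP →L[ℝ] E₁ := mfderiv IP I₁ (fun y => L.toFun (B.proj y)) p with hl
  have hmem := B.prod_mem_arrowTangent (hasMFDerivAt_toFun_proj hL) (hasMFDerivAt_id p)
    (eventually_src_toFun_proj hL) u.2
  change ((l u.2, u.2) : E₁ × EP) ∈ B.arrowTangent (L.toFun (B.proj p), p) at hmem
  rw [hLγ] at hmem
  set ds : E₁ →L[ℝ] E₀ := mfderiv I₁ I₀ 𝒢.src γ with hds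
  -- Both `u` and `(l u.2, u.2)` are tangent to `Q` with the same component along `P`, so their
  -- difference is tangent to the source fibre.
  have hY : ds (u.1 - l u.2) = 0 := by
    rw [map_sub, sub_eq_zero]
    exact ((B.mem_arrowTangent_iff _ u).1 hu).trans ((B.mem_arrowTangent_iff _ _).1 hmem).symm
  have hvert : θ.modelForm (B.act γ p) (B.targetDeriv (γ, p) (u.1 - l u.2, 0)) = 0 :=
    h _ (B.targetDeriv_mem_algebroidDirections hγp hY)
  have hbis := h'.form_mfderiv L hL u.2
  rw [(hasMFDerivAt_bisectionAct hL).mfderiv] at hbis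
  change θ.modelForm (B.act (L.toFun (B.proj p)) p)
    (B.targetDeriv (L.toFun (B.proj p), p) (l u.2, u.2)) = θ.modelForm p u.2 at hbis
  rw [hLγ] at hbis
  have hsplit : u = (u.1 - l u.2, 0) + (l u.2, u.2) := by simp
  change θ.modelForm (B.act γ p) (B.targetDeriv (γ, p) u) = θ.modelForm p u.2
  rw [hsplit, map_add, map_add, hvert, zero_add]
  simpa using hbis

end PseudoConnection

end GroupoidPrincipalBundle

theorem mainTheorem12
    {E₀ H₀ E₁ H₁ EG HG EP HP : Type*}
    [NormedAddCommGroup E₀] [NormedSpace ℝ E₀] [FiniteDimensional ℝ E₀] [TopologicalSpace H₀]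
    [NormedAddCommGroup E₁] [NormedSpace ℝ E₁] [FiniteDimensional ℝ E₁] [TopologicalSpace H₁]
    [NormedAddCommGroup EG] [NormedSpace ℝ EG] [FiniteDimensional ℝ EG] [TopologicalSpace HG]
    [NormedAddCommGroup EP] [NormedSpace ℝ EP] [FiniteDimensional ℝ EP] [TopologicalSpace HP]
    {I₀ : ModelWithCorners ℝ E₀ H₀} [I₀.Boundaryless]
    {I₁ : ModelWithCorners ℝ E₁ H₁} [I₁.Boundaryless]
    {IG : ModelWithCorners ℝ EG HG} [IG.Boundaryless]
    {IP : ModelWithCorners ℝ EP HP} [IP.Boundaryless]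
    {Γ₀ : Type*} [TopologicalSpace Γ₀] [ChartedSpace H₀ Γ₀] [IsManifold I₀ ∞ Γ₀]
    {Γ : Type*} [TopologicalSpace Γ] [ChartedSpace H₁ Γ] [IsManifold I₁ ∞ Γ]
    {G : Type*} [Group G] [TopologicalSpace G] [ChartedSpace HG G] [LieGroup IG ∞ G]
    {P : Type*} [TopologicalSpace P] [ChartedSpace HP P] [IsManifold IP ∞ P]
    {𝒢 : LieGroupoid I₀ I₁ Γ₀ Γ}
    (B : GroupoidPrincipalBundle 𝒢 IG IP G P)
    (θ : B.PseudoConnection) :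
    List.TFAE [
      θ.IsConnection,
      θ.IsBasic,
      (∀ p : P, B.algebroidDirections p ≤ θ.horizontal p) ∧ θ.HorizontalPreserved] := by

  tfae_have 1 → 2 := fun h => h.isBasic
  tfae_have 2 → 3 := fun h => h.horizontal
  tfae_have 3 → 1 := fun h => GroupoidPrincipalBundle.PseudoConnection.isConnection_of_horizontal h.1 h.2
  tfae_finish
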